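/- Let $H$ denote the Hilbert transform on $\mathbb{R}$, $$Hf(x) = -\frac1\pi\,\operatorname{pv}\!\int_{-\infty}^{\infty}\frac{f(y)}{x-y}\,dy ,$$ which is the Fourier multiplier with symbol $i\operatorname{sgn}\xi$ and is extended as such to the Sobolev spaces $H^s(\mathbb{R})$, $s\in\mathbb{R}$. Let $\chi\in C_c^\infty(\mathbb{R})$. Then there is a constant $C$, depending only on $\chi$, such that for all $0<h\le 1$ and all $w\in H^{1/2}(\mathbb{R})$, $$\left|\int_{\mathbb{R}} \chi(hy)\, w(y)\, (H\partial_y w)(y)\,dy\right| \le C\,\|w\|_{H^{1/2}}^2 .$$ Here $\chi(h\,\cdot)\,w\in H^{1/2}(\mathbb{R})$ and $H\partial_y w\in H^{-1/2}(\mathbb{R})$, and the integral is understood as the (bilinear) duality pairing of $H^{1/2}(\mathbb{R})$ with $H^{-1/2}(\mathbb{R})$. When $w$ is a Schwartz function, the principal value defining $H\partial_y w$ exists at every point, and the pairing is the absolutely convergent Lebesgue integral. -/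

import Mathlib

open MeasureTheory Filter Topology
open scoped SchwartzMap FourierTransform ContDiff ENNReal

noncomputable section

namespace HilbertForm

/-- The function `J^s u ∈ L²(ℝ)`, where `J^s` is Mathlib's Bessel potential (Fourier multiplier
`(1 + ξ²)^{s/2}`) and `u ∈ H^s(ℝ)`; it is `0` if `u ∉ H^s(ℝ)`. -/
def besselRep (s : ℝ) (u : 𝓢'(ℝ, ℂ)) : Lp ℂ 2 (volume : Measure ℝ) :=
  open Classical in
  if hu : TemperedDistribution.MemSobolev s 2 u then hu.choose else 0

/-- For `u ∈ H^s(ℝ)` the function `besselRep s u` does represent `J^s u`. -/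
theorem besselRep_spec {s : ℝ} {u : 𝓢'(ℝ, ℂ)} (hu : TemperedDistribution.MemSobolev s 2 u) :
    TemperedDistribution.besselPotential ℝ ℂ s u = (besselRep s u : 𝓢'(ℝ, ℂ)) := by
  rw [besselRep, dif_pos hu]
  exact hu.choose_spec

/-- The norm `‖u‖_{H^s} = ‖J^s u‖_{L²}` of `u ∈ H^s(ℝ)`. -/
def sobolevNorm (s : ℝ) (u : 𝓢'(ℝ, ℂ)) : ℝ := ‖besselRep s u‖

/-- The duality pairing of `u ∈ H^s(ℝ)` with `v ∈ H^{-s}(ℝ)`: the bilinear form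
`∫ J^s u · J^{-s} v`, which is `∫ u v` for Schwartz functions. -/
def dualityPairing (s : ℝ) (u v : 𝓢'(ℝ, ℂ)) : ℂ :=
  ∫ y : ℝ, besselRep s u y * besselRep (-s) v y

/-- The symbol `i sgn ξ` of the Hilbert transform. -/
def hilbertSymbol (ξ : ℝ) : ℂ := Complex.I * (Real.sign ξ : ℂ)

theorem measurable_hilbertSymbol : Measurable hilbertSymbol := by
  have h : Measurable Real.sign := by
    unfold Real.sign
    exact Measurable.ite measurableSet_Iio measurable_const
      (Measurable.ite measurableSet_Ioi measurable_const measurable_const)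
  exact (Complex.measurable_ofReal.comp h).const_mul _

theorem norm_hilbertSymbol_le (ξ : ℝ) : ‖hilbertSymbol ξ‖ ≤ 1 := by
  rcases Real.sign_apply_eq ξ with h | h | h <;> simp [hilbertSymbol, h]

theorem memLp_hilbertSymbol_mul (f : Lp ℂ 2 (volume : Measure ℝ)) :
    MemLp (fun ξ : ℝ => hilbertSymbol ξ * f ξ) 2 volume := by
  refine (Lp.memLp f).mono
    (measurable_hilbertSymbol.aestronglyMeasurable.mul (Lp.aestronglyMeasurable f))
    (Eventually.of_forall fun ξ => ?_)
  rw [norm_mul]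
  exact mul_le_of_le_one_left (norm_nonneg _) (norm_hilbertSymbol_le ξ)

/-- The Hilbert transform on `L²(ℝ)`, `(Hf)^(ξ) = i sgn(ξ) f^(ξ)`. -/
def hilbertL2 (f : Lp ℂ 2 (volume : Measure ℝ)) : Lp ℂ 2 (volume : Measure ℝ) :=
  𝓕⁻ (memLp_hilbertSymbol_mul (𝓕 f)).toLp

/-- The Hilbert transform on `H^s(ℝ)`, the Fourier multiplier `i sgn ξ`. As Fourier multipliers
commute, it is `J^{-s} H J^s` with `H` the Hilbert transform on `L²(ℝ)`. -/
def hilbert (s : ℝ) (u : 𝓢'(ℝ, ℂ)) : 𝓢'(ℝ, ℂ) :=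
  TemperedDistribution.besselPotential ℝ ℂ (-s) (hilbertL2 (besselRep s u) : 𝓢'(ℝ, ℂ))

/-- `g` is the Hilbert transform of the function `f` in the sense of principal values:
`g(x) = -(1/π) lim_{ε → 0+} ∫_{|x-y| > ε} f(y) / (x - y) dy` at every point `x`. -/
def IsPVHilbert (f g : ℝ → ℂ) : Prop :=
  ∀ x : ℝ, Tendsto
    (fun ε : ℝ => -(1 / (Real.pi : ℂ)) * ∫ y in {y : ℝ | ε < |x - y|}, f y / ((x - y : ℝ) : ℂ))
    (𝓝[>] 0) (𝓝 (g x))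

end HilbertForm

end

noncomputable section

namespace HilbertForm

open TemperedDistribution

/-! The form costs one derivative, and half of it is charged to each factor. By Cauchy–Schwarz the
pairing is at most `‖J^{1/2}(χ(h·)w)‖₂ ‖J^{-1/2}H∂w‖₂`, so no cancellation is needed. On the second
factor, `H` commutes with `J^{-1/2}` and has symbol bounded by 1, while `∂` compares with `J`
through the symbol `2πiξ(1+ξ²)^{-1/2}`, bounded by `2π`.

On the first factor, multiplication becomes convolution on the Fourier side. Peetre's inequality
distributes the weight `(1+ξ²)^{1/4}` over the two frequencies, and Young's inequality bounds the
multiplier by a weighted `L¹` norm of the transform of `χ(h·)`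
(`memSobolev_smulLeftCLM_and_norm_le`). Dilating by `h ≤ 1` concentrates this transform near the
origin without changing its `L¹` mass, so the weighted norm is at most that of `χ` itself; hence the
uniformity in `h`.

For Schwartz `w`, the multiplier is identified with the principal value by Abel regularization:
damping the symbol by `e^{-2πδ|ξ|}` yields the conjugate Poisson kernel. This kernel and the
truncated `1/t` are both odd approximations of `1/t`, so both give the same limit
(`tendsto_integral_mul_odd_kernel`). In the pairing, the two Bessel weights cancel. -/

theorem toTemperedDistribution_injective :
    Function.Injective
      (fun f : Lp ℂ 2 (volume : Measure ℝ) => (f : 𝓢'(ℝ, ℂ))) := by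
  have h := LinearMap.ker_eq_bot.mp
    (Lp.ker_toTemperedDistributionCLM_eq_bot (F := ℂ) (μ := (volume : Measure ℝ)) (p := 2))
  exact h

/-- An `L²` function is determined by its distribution, so the choice made in `besselRep` is
immaterial and any explicit representative may replace it. -/
theorem besselRep_eq {s : ℝ} {u : 𝓢'(ℝ, ℂ)} {f : Lp ℂ 2 (volume : Measure ℝ)}
    (h : besselPotential ℝ ℂ s u = (f : 𝓢'(ℝ, ℂ))) : besselRep s u = f := by
  apply toTemperedDistribution_injective
  have hu : MemSobolev s 2 u := ⟨f, h⟩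
  exact (besselRep_spec hu).symm.trans h

theorem eq_besselPotential_neg_besselRep {s : ℝ} {u : 𝓢'(ℝ, ℂ)} (hu : MemSobolev s 2 u) :
    u = besselPotential ℝ ℂ (-s) (besselRep s u : 𝓢'(ℝ, ℂ)) := by
  rw [← besselRep_spec hu, besselPotential_besselPotential_apply]
  simp

/-- A continuous operator on tempered distributions that preserves Schwartz functions and is
bounded on them in the `L²` norm is bounded on `L²`. -/
theorem exists_Lp_of_schwartz_bound (A : 𝓢'(ℝ, ℂ) →L[ℂ] 𝓢'(ℝ, ℂ))
    (S : 𝓢(ℝ, ℂ) →L[ℂ] 𝓢(ℝ, ℂ)) (hAS : ∀ f : 𝓢(ℝ, ℂ), A (f : 𝓢'(ℝ, ℂ)) = (S f : 𝓢'(ℝ, ℂ)))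
    {C : ℝ} (hC : ∀ f : 𝓢(ℝ, ℂ), ‖(S f).toLp 2 volume‖ ≤ C * ‖f.toLp 2 volume‖)
    (f : Lp ℂ 2 (volume : Measure ℝ)) :
    ∃ g : Lp ℂ 2 (volume : Measure ℝ), A (f : 𝓢'(ℝ, ℂ)) = (g : 𝓢'(ℝ, ℂ)) ∧ ‖g‖ ≤ C * ‖f‖ := by
  have hd : DenseRange (SchwartzMap.toLpCLM ℂ (E := ℝ) ℂ 2 volume) :=
    SchwartzMap.denseRange_toLpCLM ENNReal.ofNat_ne_top
  set e : 𝓢(ℝ, ℂ) →ₗ[ℂ] Lp ℂ 2 (volume : Measure ℝ) :=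
    (SchwartzMap.toLpCLM ℂ (E := ℝ) ℂ 2 volume).toLinearMap with he
  set T := (e ∘ₗ S.toLinearMap).extendOfNorm e with hT
  have hb : ∀ x, ‖(e ∘ₗ S.toLinearMap) x‖ ≤ C * ‖e x‖ := hC
  refine ⟨T f, ?_, LinearMap.norm_extendOfNorm_apply_le hd C hb f⟩
  -- Both sides are continuous in `f`, so the identity only has to be checked on the dense Schwartz
  -- functions.
  set p := fun f : Lp ℂ 2 (volume : Measure ℝ) => A (f : 𝓢'(ℝ, ℂ)) = (T f : 𝓢'(ℝ, ℂ)) with hp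
  apply DenseRange.induction_on (p := p) hd f
  · apply isClosed_eq
    · exact (A ∘L Lp.toTemperedDistributionCLM ℂ volume 2).continuous
    · exact (Lp.toTemperedDistributionCLM ℂ volume 2 ∘L T).continuous
  intro f
  have h1 : T (e f) = (S f).toLp 2 volume := LinearMap.extendOfNorm_eq hd ⟨C, hb⟩ f
  have h2 : T (SchwartzMap.toLpCLM ℂ (E := ℝ) ℂ 2 volume f) = (S f).toLp 2 volume := h1
  simp only [hp]
  rw [h2, Lp.toTemperedDistribution_toLp_eq, ← hAS, SchwartzMap.toLpCLM_apply,
    Lp.toTemperedDistribution_toLp_eq]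

/-! ### Plancherel bounds for multipliers and Cauchy–Schwarz -/

theorem norm_toLp_mul_le {m : ℝ → ℂ} {C : ℝ} (hm : ∀ x, ‖m x‖ ≤ C)
    (f : Lp ℂ 2 (volume : Measure ℝ)) (h : MemLp (fun x => m x * f x) 2 volume) :
    ‖h.toLp‖ ≤ C * ‖f‖ := by
  apply Lp.norm_le_mul_norm_of_ae_le_mul
  filter_upwards [h.coeFn_toLp] with x hx
  rw [hx, norm_mul]
  gcongr
  exact hm x

theorem norm_hilbertL2_le (f : Lp ℂ 2 (volume : Measure ℝ)) : ‖hilbertL2 f‖ ≤ ‖f‖ := by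
  have h1 : ‖hilbertL2 f‖ = ‖(memLp_hilbertSymbol_mul (𝓕 f)).toLp‖ :=
    (Lp.fourierTransformₗᵢ ℝ ℂ).symm.norm_map _
  rw [h1]
  refine (norm_toLp_mul_le norm_hilbertSymbol_le _ _).trans ?_
  simp

/-- A Fourier multiplier with bounded symbol is bounded on `L²`. -/
theorem exists_Lp_fourierMultiplierCLM {m : ℝ → ℂ} (hm : m.HasTemperateGrowth) {C : ℝ}
    (hmC : ∀ x, ‖m x‖ ≤ C) (f : Lp ℂ 2 (volume : Measure ℝ)) :
    ∃ g : Lp ℂ 2 (volume : Measure ℝ),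
      fourierMultiplierCLM ℂ m (f : 𝓢'(ℝ, ℂ)) = (g : 𝓢'(ℝ, ℂ)) ∧ ‖g‖ ≤ C * ‖f‖ := by
  have hL : MemLp (fun x => m x * (𝓕 f : Lp ℂ 2 (volume : Measure ℝ)) x) 2 volume := by
    refine (Lp.memLp (𝓕 f)).of_le_mul (c := C)
      (hm.1.continuous.aestronglyMeasurable.mul (Lp.aestronglyMeasurable _))
      (Eventually.of_forall fun x => ?_)
    rw [norm_mul]
    gcongr
    exact hmC x
  refine ⟨𝓕⁻ hL.toLp, ?_, ?_⟩
  · rw [fourierMultiplierCLM_apply, ← Lp.fourierInv_toTemperedDistribution_eq,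
      Lp.fourier_toTemperedDistribution_eq]
    congr 1
    ext u
    rw [smulLeftCLM_apply_apply, Lp.toTemperedDistribution_apply, Lp.toTemperedDistribution_apply]
    apply integral_congr_ae
    filter_upwards [hL.coeFn_toLp] with x hx
    rw [hx, SchwartzMap.smulLeftCLM_apply_apply hm]
    simp only [smul_eq_mul]
    ring
  · have h1 : ‖(𝓕⁻ hL.toLp : Lp ℂ 2 (volume : Measure ℝ))‖ = ‖hL.toLp‖ :=
      (Lp.fourierTransformₗᵢ ℝ ℂ).symm.norm_map _
    rw [h1]
    refine (norm_toLp_mul_le hmC _ _).trans ?_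
    simp

/-- The pairing is bilinear, so Cauchy–Schwarz for the sesquilinear inner product is applied to the
conjugate of `f`, which has the same norm. -/
theorem norm_integral_mul_le (f g : Lp ℂ 2 (volume : Measure ℝ)) :
    ‖∫ x : ℝ, f x * g x‖ ≤ ‖f‖ * ‖g‖ := by
  have h : ∫ x : ℝ, f x * g x = inner ℂ (star f) g := by
    rw [L2.inner_def]
    apply integral_congr_ae
    filter_upwards [Lp.coeFn_star f] with x hx
    rw [hx]
    simp [mul_comm]
  rw [h]
  refine (norm_inner_le_norm _ _).trans (le_of_eq ?_)
  congr 1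
  rw [Lp.norm_def, Lp.norm_def, eLpNorm_congr_norm_ae (g := f)]
  filter_upwards [Lp.coeFn_star f] with x hx
  rw [hx]
  simp

/-! ### The derivative and the Hilbert transform on Sobolev spaces -/

theorem derivCLM_eq_fourierMultiplierCLM (u : 𝓢'(ℝ, ℂ)) :
    TemperedDistribution.derivCLM ℂ u =
      fourierMultiplierCLM ℂ (fun ξ : ℝ => 2 * Real.pi * Complex.I * (ξ : ℂ)) u := by
  have h1 : TemperedDistribution.derivCLM ℂ u = LineDeriv.lineDerivOp (1 : ℝ) u := by
    ext g
    rw [TemperedDistribution.derivCLM_apply_apply, TemperedDistribution.lineDerivOp_apply_apply]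
    congr 2
  have h2 : (fun ξ : ℝ => 2 * Real.pi * Complex.I * (ξ : ℂ)) =
      (2 * Real.pi * Complex.I) • (fun ξ : ℝ => (ξ : ℂ)) := by
    ext; simp
  rw [h1, TemperedDistribution.lineDeriv_eq_fourierMultiplierCLM, h2,
    TemperedDistribution.fourierMultiplierCLM_smul (by fun_prop)]
  simp

theorem norm_mul_rpow_one_add_sq_le (ξ : ℝ) :
    ‖((ξ : ℂ) * (((1 + ‖ξ‖ ^ 2) ^ (-(1 / 2 : ℝ)) : ℝ) : ℂ))‖ ≤ 1 := by
  rw [← Complex.ofReal_mul, Complex.norm_real, norm_mul,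
    Real.norm_of_nonneg (r := (1 + ‖ξ‖ ^ 2) ^ (-(1 / 2 : ℝ))) (by positivity),
    Real.rpow_neg (by positivity), ← Real.sqrt_eq_rpow, mul_inv_le_iff₀ (by positivity), one_mul]
  exact Real.le_sqrt_of_sq_le (by linarith)

/-- The derivative maps `H^{1/2}` to `H^{-1/2}`. -/
theorem memSobolev_derivCLM_and_norm_le {w : 𝓢'(ℝ, ℂ)} (hw : MemSobolev (1 / 2) 2 w) :
    MemSobolev (-(1 / 2)) 2 (TemperedDistribution.derivCLM ℂ w) ∧
      ‖besselRep (-(1 / 2)) (TemperedDistribution.derivCLM ℂ w)‖ ≤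
        2 * Real.pi * sobolevNorm (1 / 2) w := by
  have hm : (fun ξ : ℝ => 2 * Real.pi * Complex.I *
      ((ξ : ℂ) * (((1 + ‖ξ‖ ^ 2) ^ (-(1 / 2 : ℝ)) : ℝ) : ℂ))).HasTemperateGrowth := by
    fun_prop
  obtain ⟨g, hg, hgn⟩ := exists_Lp_fourierMultiplierCLM hm (C := 2 * Real.pi)
    (fun ξ => by
      rw [norm_mul]
      refine (mul_le_of_le_one_right (norm_nonneg _) (norm_mul_rpow_one_add_sq_le ξ)).trans ?_
      simp [abs_of_pos Real.pi_pos]) (besselRep (1 / 2) w)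
  have h : besselPotential ℝ ℂ (-(1 / 2)) (TemperedDistribution.derivCLM ℂ w) =
      (g : 𝓢'(ℝ, ℂ)) := by
    rw [← hg, ← besselRep_spec hw, derivCLM_eq_fourierMultiplierCLM, besselPotential,
      besselPotential, fourierMultiplierCLM_fourierMultiplierCLM_apply (by fun_prop) (by fun_prop),
      fourierMultiplierCLM_fourierMultiplierCLM_apply (by fun_prop) (by fun_prop)]
    congr 2
    ext ξ
    simp only [Pi.mul_apply]
    -- Passing from `J^{1/2}` to `J^{-1/2}` leaves the factor `(1+ξ²)^{-1/2}`, which absorbs the `ξ`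
    -- of the derivative.
    have : (1 + ‖ξ‖ ^ 2) ^ (-(1 / 2 : ℝ) / 2) =
        (1 + ‖ξ‖ ^ 2) ^ ((1 / 2 : ℝ) / 2) * (1 + ‖ξ‖ ^ 2) ^ (-(1 / 2 : ℝ)) := by
      rw [← Real.rpow_add (by positivity)]
      norm_num
    rw [this]
    push_cast
    ring
  refine ⟨⟨g, h⟩, ?_⟩
  rw [besselRep_eq h]
  exact hgn

theorem besselRep_hilbert (s : ℝ) (u : 𝓢'(ℝ, ℂ)) :
    besselRep s (hilbert s u) = hilbertL2 (besselRep s u) := by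
  apply besselRep_eq
  simp [hilbert]

theorem memSobolev_hilbert (s : ℝ) (u : 𝓢'(ℝ, ℂ)) : MemSobolev s 2 (hilbert s u) :=
  ⟨hilbertL2 (besselRep s u), by simp [hilbert]⟩

/-! ### Multiplication by a Schwartz function on Sobolev spaces -/

/-- The Young inequality `‖k * g‖₂ ≤ ‖k‖₁ ‖g‖₂` for nonnegative functions, squared. -/
theorem lintegral_convolution_sq_le {k g : ℝ → ℝ≥0∞} (hk : Measurable k) (hg : Measurable g) :
    ∫⁻ x, (∫⁻ y, k y * g (x - y)) ^ 2 ≤ (∫⁻ y, k y) ^ 2 * ∫⁻ y, g y ^ 2 := by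
  have hCS : ∀ x, (∫⁻ y, k y * g (x - y)) ^ 2 ≤ (∫⁻ y, k y) * ∫⁻ y, k y * g (x - y) ^ 2 := by
    intro x
    -- Cauchy–Schwarz for the splitting `k g = k^{1/2} · (k^{1/2} g)`.
    have h := ENNReal.lintegral_mul_le_Lp_mul_Lq (μ := (volume : Measure ℝ))
      (p := 2) (q := 2) (by exact Real.HolderConjugate.two_two)
      (f := fun y => k y ^ (1 / 2 : ℝ)) (g := fun y => k y ^ (1 / 2 : ℝ) * g (x - y))
      (by fun_prop) (by fun_prop)
    have e1 : ∀ y, k y ^ (1 / 2 : ℝ) * (k y ^ (1 / 2 : ℝ) * g (x - y)) = k y * g (x - y) := by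
      intro y
      rw [← mul_assoc, ← ENNReal.rpow_add_of_nonneg _ _ (by norm_num) (by norm_num)]
      norm_num
    have e2 : ∀ y, (k y ^ (1 / 2 : ℝ)) ^ (2 : ℝ) = k y := by
      intro y
      rw [← ENNReal.rpow_mul]
      norm_num
    have e3 : ∀ y, (k y ^ (1 / 2 : ℝ) * g (x - y)) ^ (2 : ℝ) = k y * g (x - y) ^ 2 := by
      intro y
      rw [ENNReal.mul_rpow_of_nonneg _ _ (by norm_num), e2]
      norm_num
    simp only [Pi.mul_apply, e1, e2, e3] at h
    calc (∫⁻ y, k y * g (x - y)) ^ 2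
        ≤ ((∫⁻ y, k y) ^ (1 / 2 : ℝ) * (∫⁻ y, k y * g (x - y) ^ 2) ^ (1 / 2 : ℝ)) ^ 2 := by
          gcongr
      _ = _ := by
          rw [mul_pow, ← ENNReal.rpow_mul_natCast, ← ENNReal.rpow_mul_natCast]
          norm_num
  calc ∫⁻ x, (∫⁻ y, k y * g (x - y)) ^ 2
      ≤ ∫⁻ x, (∫⁻ y, k y) * ∫⁻ y, k y * g (x - y) ^ 2 := lintegral_mono hCS
    _ = (∫⁻ y, k y) * ∫⁻ x, ∫⁻ y, k y * g (x - y) ^ 2 := by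
        rw [lintegral_const_mul]
        exact Measurable.lintegral_prod_right' (f := fun p : ℝ × ℝ => k p.2 * g (p.1 - p.2) ^ 2)
          (by fun_prop)
    _ = (∫⁻ y, k y) * ∫⁻ y, ∫⁻ x, k y * g (x - y) ^ 2 := by
        rw [lintegral_lintegral_swap]
        exact Measurable.aemeasurable (by unfold Function.uncurry; fun_prop)
    _ = (∫⁻ y, k y) * ∫⁻ y, k y * ∫⁻ x, g x ^ 2 := by
        congr 1
        refine lintegral_congr fun y => ?_
        rw [lintegral_const_mul _ (by fun_prop),
          lintegral_sub_right_eq_self (fun x => g x ^ 2) y]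
    _ = _ := by
        rw [lintegral_mul_const _ hk]
        ring

/-- The Peetre inequality. -/
theorem one_add_sq_rpow_le {r : ℝ} (hr : 0 ≤ r) (x y : ℝ) :
    (1 + ‖x‖ ^ 2) ^ r ≤ (2 * (1 + ‖y‖ ^ 2)) ^ r * (1 + ‖x - y‖ ^ 2) ^ r := by
  rw [← Real.mul_rpow (by positivity) (by positivity)]
  apply Real.rpow_le_rpow (by positivity) _ hr
  simp only [Real.norm_eq_abs, sq_abs]
  -- Right side minus left side equals `1 + (x-2y)² + 2(y(x-y))²`.
  nlinarith [sq_nonneg (x - 2 * y), sq_nonneg (y * (x - y))]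

/-- The convolution theorem, which turns convolutions into products, is applied to the inverse
transforms; reflecting `ξ` then converts these back to forward transforms. -/
theorem fourier_mul_eq_integral (φ v p : 𝓢(ℝ, ℂ)) (hp : ∀ x, p x = φ x * v x) (ξ : ℝ) :
    𝓕 p ξ = ∫ η, 𝓕 φ η * 𝓕 v (ξ - η) := by
  have hneg : ∀ (f : 𝓢(ℝ, ℂ)) (x : ℝ), 𝓕⁻ f x = 𝓕 f (-x) := by
    intro f x
    rw [SchwartzMap.fourierInv_coe, SchwartzMap.fourier_coe, Real.fourierInv_eq_fourier_neg]
  have h1 : 𝓕⁻ p = SchwartzMap.convolution (ContinuousLinearMap.mul ℂ ℂ) (𝓕⁻ φ) (𝓕⁻ v) := by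
    have : 𝓕 (SchwartzMap.convolution (ContinuousLinearMap.mul ℂ ℂ) (𝓕⁻ φ) (𝓕⁻ v)) = p := by
      rw [SchwartzMap.fourier_convolution]
      ext x
      simp [hp]
    rw [← this]
    simp
  have h2 : 𝓕 p ξ = 𝓕⁻ p (-ξ) := by rw [hneg, neg_neg]
  rw [h2, h1, SchwartzMap.convolution_apply, convolution_def, ← integral_neg_eq_self]
  refine integral_congr_ae (Eventually.of_forall fun η => ?_)
  simp only [ContinuousLinearMap.mul_apply', hneg]
  congr 2 <;> ring

/-- Multiplication by a Schwartz function `φ` conjugated with Bessel potentials is bounded on `L²`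
by a weighted `L¹` norm of the Fourier transform of `φ`. -/
theorem norm_bessel_mul_bessel_le {r : ℝ} (hr : 0 ≤ r) (φ f v p q : 𝓢(ℝ, ℂ))
    (hv : ∀ ξ, 𝓕 f ξ = (((1 + ‖ξ‖ ^ 2) ^ r : ℝ) : ℂ) * 𝓕 v ξ)
    (hp : ∀ x, p x = φ x * v x)
    (hq : ∀ ξ, 𝓕 q ξ = (((1 + ‖ξ‖ ^ 2) ^ r : ℝ) : ℂ) * 𝓕 p ξ)
    (hint : Integrable fun η => (2 * (1 + ‖η‖ ^ 2)) ^ r * ‖𝓕 φ η‖) :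
    ‖q.toLp 2 volume‖ ≤ (∫ η, (2 * (1 + ‖η‖ ^ 2)) ^ r * ‖𝓕 φ η‖) * ‖f.toLp 2 volume‖ := by
  set I := ∫ η, (2 * (1 + ‖η‖ ^ 2)) ^ r * ‖𝓕 φ η‖ with hI
  have hI0 : 0 ≤ I := integral_nonneg fun η => by positivity
  set k : ℝ → ℝ≥0∞ := fun η => ENNReal.ofReal ((2 * (1 + ‖η‖ ^ 2)) ^ r * ‖𝓕 φ η‖) with hk
  have hkm : Measurable k := by
    apply ENNReal.measurable_ofReal.comp
    apply Measurable.mul (by fun_prop)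
    exact (𝓕 φ).continuous.norm.measurable
  have hgm : Measurable fun x => ‖𝓕 f x‖ₑ := (𝓕 f).continuous.enorm.measurable
  have hkI : ∫⁻ η, k η = ENNReal.ofReal I :=
    (ofReal_integral_eq_lintegral_ofReal hint
      (Eventually.of_forall fun η => by positivity)).symm
  have hw : ∀ x : ℝ, ‖(((1 + ‖x‖ ^ 2) ^ r : ℝ) : ℂ)‖ = (1 + ‖x‖ ^ 2) ^ r := fun x => by
    rw [Complex.norm_real, Real.norm_of_nonneg (by positivity)]
  have hpt : ∀ ξ, ‖𝓕 q ξ‖ₑ ≤ ∫⁻ η, k η * ‖𝓕 f (ξ - η)‖ₑ := by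
    intro ξ
    rw [hq, fourier_mul_eq_integral φ v p hp, ← integral_const_mul]
    refine (enorm_integral_le_lintegral_enorm _).trans (lintegral_mono fun η => ?_)
    rw [← ofReal_norm, ← ofReal_norm, ← ENNReal.ofReal_mul (by positivity)]
    apply ENNReal.ofReal_le_ofReal
    rw [hv, norm_mul, norm_mul, norm_mul, hw, hw]
    calc _ ≤ ((2 * (1 + ‖η‖ ^ 2)) ^ r * (1 + ‖ξ - η‖ ^ 2) ^ r) * (‖𝓕 φ η‖ * ‖𝓕 v (ξ - η)‖) := by
          gcongr
          exact one_add_sq_rpow_le hr ξ η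
      _ = _ := by ring
  have hsq : ∫⁻ ξ, ‖𝓕 q ξ‖ₑ ^ 2 ≤ ENNReal.ofReal I ^ 2 * ∫⁻ ξ, ‖𝓕 f ξ‖ₑ ^ 2 := by
    rw [← hkI]
    refine (lintegral_mono fun ξ => ?_).trans (lintegral_convolution_sq_le hkm hgm)
    gcongr
    exact hpt ξ
  have hnorm : ∀ u : 𝓢(ℝ, ℂ), ENNReal.ofReal (‖u.toLp 2 volume‖ ^ 2) = ∫⁻ x, ‖u x‖ₑ ^ 2 := by
    intro u
    rw [SchwartzMap.norm_toLp, ← ENNReal.toReal_pow,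
      ENNReal.ofReal_toReal (by finiteness [(u.memLp 2 volume).2.ne]),
      eLpNorm_eq_lintegral_rpow_enorm_toReal (by norm_num) (by norm_num),
      ← ENNReal.rpow_mul_natCast]
    norm_num
  have hq' : ‖q.toLp 2 volume‖ = ‖(𝓕 q).toLp 2 volume‖ := by simp
  have hf' : ‖f.toLp 2 volume‖ = ‖(𝓕 f).toLp 2 volume‖ := by simp
  rw [hq', hf']
  apply le_of_sq_le_sq _ (by positivity)
  rw [mul_pow, ← ENNReal.ofReal_le_ofReal_iff (by positivity), ENNReal.ofReal_mul (by positivity),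
    hnorm, hnorm, ENNReal.ofReal_pow hI0]
  exact hsq

theorem smulLeftCLM_toTemperedDistributionCLM {g : ℝ → ℂ} (hg : g.HasTemperateGrowth)
    (f : 𝓢(ℝ, ℂ)) :
    TemperedDistribution.smulLeftCLM ℂ g (f : 𝓢'(ℝ, ℂ)) =
      (SchwartzMap.smulLeftCLM ℂ g f : 𝓢'(ℝ, ℂ)) := by
  ext u
  rw [TemperedDistribution.smulLeftCLM_apply_apply, SchwartzMap.coe_apply, SchwartzMap.coe_apply]
  refine integral_congr_ae (Eventually.of_forall fun x => ?_)
  simp only [SchwartzMap.smulLeftCLM_apply_apply hg, smul_eq_mul]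
  ring

theorem integrable_weight_mul_norm (r : ℝ) (u : 𝓢(ℝ, ℂ)) :
    Integrable fun η : ℝ => (2 * (1 + ‖η‖ ^ 2)) ^ r * ‖u η‖ := by
  have hg : (fun η : ℝ => (((1 + ‖η‖ ^ 2) ^ r : ℝ) : ℂ)).HasTemperateGrowth := by fun_prop
  have h := ((SchwartzMap.smulLeftCLM ℂ (fun η : ℝ => (((1 + ‖η‖ ^ 2) ^ r : ℝ) : ℂ)) u).integrable
    (μ := volume)).norm.const_mul ((2 : ℝ) ^ r)
  refine h.congr (Eventually.of_forall fun η => ?_)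
  simp only [SchwartzMap.smulLeftCLM_apply_apply hg]
  rw [norm_smul, Complex.norm_real, Real.norm_of_nonneg (by positivity),
    Real.mul_rpow (by positivity) (by positivity)]
  ring

/-- Multiplication by a Schwartz function is bounded on `H^s`, `s ≥ 0`. -/
theorem memSobolev_smulLeftCLM_and_norm_le {s : ℝ} (hs : 0 ≤ s) (φ : 𝓢(ℝ, ℂ)) {w : 𝓢'(ℝ, ℂ)}
    (hw : MemSobolev s 2 w) :
    MemSobolev s 2 (TemperedDistribution.smulLeftCLM ℂ φ w) ∧
      ‖besselRep s (TemperedDistribution.smulLeftCLM ℂ φ w)‖ ≤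
        (∫ η : ℝ, (2 * (1 + ‖η‖ ^ 2)) ^ (s / 2) * ‖𝓕 φ η‖) * sobolevNorm s w := by
  have hφ : (φ : ℝ → ℂ).HasTemperateGrowth := φ.hasTemperateGrowth
  have hm : ∀ t : ℝ, (fun x : ℝ => (((1 + ‖x‖ ^ 2) ^ (t / 2) : ℝ) : ℂ)).HasTemperateGrowth :=
    fun t => by fun_prop
  -- The conjugated operator `J^s φ J^{-s}` is applied to `J^s w`, so an `L²` bound for it is an
  -- `H^s` bound for multiplication by `φ`.
  obtain ⟨g, hg, hgn⟩ := exists_Lp_of_schwartz_bound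
    (besselPotential ℝ ℂ s ∘L TemperedDistribution.smulLeftCLM ℂ φ ∘L besselPotential ℝ ℂ (-s))
    (SchwartzMap.fourierMultiplierCLM ℂ (fun x : ℝ => (((1 + ‖x‖ ^ 2) ^ (s / 2) : ℝ) : ℂ)) ∘L
      SchwartzMap.smulLeftCLM ℂ φ ∘L
      SchwartzMap.fourierMultiplierCLM ℂ (fun x : ℝ => (((1 + ‖x‖ ^ 2) ^ (-s / 2) : ℝ) : ℂ)))
    (fun f => by
      simp only [ContinuousLinearMap.comp_apply, besselPotential]
      rw [fourierMultiplierCLM_toTemperedDistributionCLM_eq (hm (-s)),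
        smulLeftCLM_toTemperedDistributionCLM hφ,
        fourierMultiplierCLM_toTemperedDistributionCLM_eq (hm s)])
    (C := ∫ η : ℝ, (2 * (1 + ‖η‖ ^ 2)) ^ (s / 2) * ‖𝓕 φ η‖)
    (fun f => by
      refine norm_bessel_mul_bessel_le (by positivity) φ f
        (SchwartzMap.fourierMultiplierCLM ℂ
          (fun x : ℝ => (((1 + ‖x‖ ^ 2) ^ (-s / 2) : ℝ) : ℂ)) f) _ _ (fun ξ => ?_)
        (SchwartzMap.smulLeftCLM_apply_apply hφ _) (fun ξ => ?_) (integrable_weight_mul_norm _ _)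
      · rw [SchwartzMap.fourierMultiplierCLM_apply, FourierTransform.fourier_fourierInv_eq,
          SchwartzMap.smulLeftCLM_apply_apply (hm (-s)), smul_eq_mul, ← mul_assoc,
          ← Complex.ofReal_mul, ← Real.rpow_add (by positivity)]
        simp [neg_div]
      · simp only [ContinuousLinearMap.comp_apply]
        rw [SchwartzMap.fourierMultiplierCLM_apply, FourierTransform.fourier_fourierInv_eq,
          SchwartzMap.smulLeftCLM_apply_apply (hm s), smul_eq_mul])
    (besselRep s w)
  have h : besselPotential ℝ ℂ s (TemperedDistribution.smulLeftCLM ℂ φ w) = (g : 𝓢'(ℝ, ℂ)) := by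
    rw [← hg]
    simp only [ContinuousLinearMap.comp_apply]
    rw [← eq_besselPotential_neg_besselRep hw]
  refine ⟨⟨g, h⟩, ?_⟩
  rw [besselRep_eq h]
  exact hgn

/-! ### Uniformity under dilation -/

theorem fourier_comp_mul_left (f : ℝ → ℂ) {h : ℝ} (hh : 0 < h) (η : ℝ) :
    𝓕 (fun y => f (h * y)) η = (h⁻¹ : ℂ) * 𝓕 f (η / h) := by
  rw [Real.fourier_real_eq, Real.fourier_real_eq]
  have := Measure.integral_comp_mul_left (fun z : ℝ => Real.fourierChar (-(z * (η / h))) • f z) h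
  rw [abs_of_pos (inv_pos.mpr hh)] at this
  rw [← Complex.ofReal_inv, ← smul_eq_mul, Complex.coe_smul, ← this]
  refine integral_congr_ae (Eventually.of_forall fun y => ?_)
  simp only
  congr 3
  field_simp

/-- Dilation by `h ≤ 1` does not increase the weighted `L¹` norm of the Fourier transform. -/
theorem integral_weight_mul_norm_fourier_dilation_le {r : ℝ} (hr : 0 ≤ r) (φ φh : 𝓢(ℝ, ℂ)) {h : ℝ}
    (hh : 0 < h) (hh1 : h ≤ 1) (hφ : ∀ y, φh y = φ (h * y)) :
    ∫ η : ℝ, (2 * (1 + ‖η‖ ^ 2)) ^ r * ‖𝓕 φh η‖ ≤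
      ∫ η : ℝ, (2 * (1 + ‖η‖ ^ 2)) ^ r * ‖𝓕 φ η‖ := by
  have h1 : ∀ η, 𝓕 φh η = (h⁻¹ : ℂ) * 𝓕 φ (η / h) := by
    intro η
    rw [SchwartzMap.fourier_coe, SchwartzMap.fourier_coe, ← fourier_comp_mul_left _ hh, ← funext hφ]
  have h2 : ∫ η : ℝ, (2 * (1 + ‖η‖ ^ 2)) ^ r * ‖𝓕 φh η‖ =
      ∫ η : ℝ, (2 * (1 + ‖h * η‖ ^ 2)) ^ r * ‖𝓕 φ η‖ := by
    have := Measure.integral_comp_div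
      (fun z : ℝ => h⁻¹ * ((2 * (1 + ‖h * z‖ ^ 2)) ^ r * ‖𝓕 φ z‖)) h
    rw [abs_of_pos hh, smul_eq_mul, integral_const_mul _ fun z : ℝ => _ * ‖𝓕 φ z‖,
      mul_inv_cancel_left₀ hh.ne'] at this
    rw [← this]
    refine integral_congr_ae (Eventually.of_forall fun η => ?_)
    simp only [h1, norm_mul, mul_div_cancel₀ _ hh.ne', norm_inv, Complex.norm_real]
    rw [Real.norm_of_nonneg hh.le]
    ring
  rw [h2]
  -- After the substitution `h` survives only in the weight, where `h ≤ 1` makes it harmless.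
  have hle : ∀ η : ℝ, (2 * (1 + ‖h * η‖ ^ 2)) ^ r * ‖𝓕 φ η‖ ≤
      (2 * (1 + ‖η‖ ^ 2)) ^ r * ‖𝓕 φ η‖ := by
    intro η
    gcongr
    rw [norm_mul, Real.norm_of_nonneg hh.le]
    exact mul_le_of_le_one_left (norm_nonneg _) hh1
  exact integral_mono_of_nonneg (Eventually.of_forall fun η => by positivity)
    (integrable_weight_mul_norm r (𝓕 φ)) (Eventually.of_forall hle)

/-! ### The principal value as a Fourier multiplier -/

theorem integral_fourier_mul_eq {f g : ℝ → ℂ} (hf : Integrable f) (hg : Integrable g) :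
    ∫ ξ, 𝓕 f ξ * g ξ = ∫ x, f x * 𝓕 g x := by
  have h := VectorFourier.integral_fourierIntegral_smul_eq_flip (L := innerₗ ℝ)
    Real.continuous_fourierChar continuous_inner hf hg
  rw [flip_innerₗ] at h
  exact h

theorem exists_norm_sub_le (f : 𝓢(ℝ, ℂ)) : ∃ M : ℝ, 0 ≤ M ∧ ∀ a b, ‖f a - f b‖ ≤ M * |a - b| := by
  refine ⟨SchwartzMap.seminorm ℝ 0 0 (SchwartzMap.derivCLM ℂ ℂ f), by positivity, fun a b => ?_⟩
  refine Convex.norm_image_sub_le_of_norm_deriv_le (s := Set.univ) (fun x _ => f.differentiableAt)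
    (fun x _ => ?_) convex_univ (Set.mem_univ _) (Set.mem_univ _)
  exact SchwartzMap.norm_le_seminorm ℝ (SchwartzMap.derivCLM ℂ ℂ f) x

/-- The odd difference quotient `(f(x-t) - f(x+t)) / t` of a Schwartz function is integrable. -/
theorem integrable_odd_quotient (f : 𝓢(ℝ, ℂ)) (x : ℝ) :
    Integrable fun t : ℝ => (f (x - t) - f (x + t)) / (t : ℂ) := by
  obtain ⟨M, hM, hf⟩ := exists_norm_sub_le f
  have h1 : Integrable fun t : ℝ => f (x - t) := f.integrable.comp_sub_left x
  have h2 : Integrable fun t : ℝ => f (x + t) := f.integrable.comp_add_left x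
  have h3 : Integrable ((Set.Icc (-1 : ℝ) 1).indicator fun _ : ℝ => 2 * M) :=
    (integrable_indicator_iff measurableSet_Icc).mpr continuous_const.integrableOn_Icc
  -- For `|t| ≤ 1` the Lipschitz bound gives `2M`; for larger `|t|` the denominator is at least 1.
  refine Integrable.mono' ((h3.add h1.norm).add h2.norm) ?_ (Eventually.of_forall fun t => ?_)
  · apply Measurable.aestronglyMeasurable
    have := f.continuous.measurable
    fun_prop
  · simp only [Pi.add_apply, norm_div, Complex.norm_real, Real.norm_eq_abs]
    by_cases ht : t ∈ Set.Icc (-1 : ℝ) 1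
    · rw [Set.indicator_of_mem ht]
      have h : ‖f (x - t) - f (x + t)‖ / |t| ≤ 2 * M := by
        refine div_le_of_le_mul₀ (abs_nonneg _) (by positivity) ((hf _ _).trans (le_of_eq ?_))
        have : x - t - (x + t) = -2 * t := by ring
        rw [this, abs_mul]
        norm_num
        ring
      have := norm_nonneg (f (x - t))
      have := norm_nonneg (f (x + t))
      linarith
    · rw [Set.indicator_of_notMem ht, zero_add]
      have h1 : 1 ≤ |t| := by
        by_contra! h
        exact ht ⟨(abs_lt.mp h).1.le, (abs_lt.mp h).2.le⟩
      exact (div_le_self (norm_nonneg _) h1).trans (norm_sub_le _ _)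

/-- Averaging the integral with its image under `t ↦ -t` exposes the cancellation: the singularity
of `k` at 0 is paired with a difference of values of `f`. -/
theorem integral_mul_odd_kernel (f : 𝓢(ℝ, ℂ)) (x : ℝ) {k : ℝ → ℝ} (hk : Measurable k)
    (hodd : ∀ t, k (-t) = -k t) {B : ℝ} (hB : ∀ t, |k t| ≤ B) :
    ∫ t, f (x - t) * (k t : ℂ) =
      1 / 2 * ∫ t, (f (x - t) - f (x + t)) / (t : ℂ) * ((t * k t : ℝ) : ℂ) := by
  have h1 : Integrable fun t : ℝ => f (x - t) * (k t : ℂ) := by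
    refine (f.integrable.comp_sub_left x).mul_bdd (c := B) ?_ (Eventually.of_forall fun t => ?_)
    · exact (Complex.measurable_ofReal.comp hk).aestronglyMeasurable
    · simpa using hB t
  have h2 : ∫ t, f (x - t) * (k t : ℂ) = ∫ t, f (x - (-t)) * (k (-t) : ℂ) :=
    (integral_neg_eq_self (fun t => f (x - t) * (k t : ℂ)) volume).symm
  have h3 : ∫ t, (f (x - t) - f (x + t)) / (t : ℂ) * ((t * k t : ℝ) : ℂ) =
      ∫ t, (f (x - t) * (k t : ℂ) + f (x - (-t)) * (k (-t) : ℂ)) := by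
    refine integral_congr_ae ?_
    filter_upwards [compl_mem_ae_iff.mpr (measure_singleton (0 : ℝ))] with t ht
    have ht' : (t : ℂ) ≠ 0 := by simpa using ht
    rw [hodd, sub_neg_eq_add]
    push_cast
    field_simp
    ring
  rw [h3, integral_add h1 h1.comp_neg, ← h2]
  ring

/-- Odd kernels `k_ε` with `|t k_ε(t)| ≤ 1` and `t k_ε(t) → 1` approximate the principal value. -/
theorem tendsto_integral_mul_odd_kernel (f : 𝓢(ℝ, ℂ)) (x : ℝ) {k : ℝ → ℝ → ℝ}
    (hk : ∀ ε, Measurable (k ε)) (hodd : ∀ ε t, k ε (-t) = -k ε t)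
    (hB : ∀ ε > 0, ∀ t, |k ε t| ≤ ε⁻¹) (h1 : ∀ ε > 0, ∀ t, |t * k ε t| ≤ 1)
    (hlim : ∀ t ≠ 0, Tendsto (fun ε => t * k ε t) (𝓝[>] 0) (𝓝 1)) :
    Tendsto (fun ε => ∫ t, f (x - t) * (k ε t : ℂ)) (𝓝[>] 0)
      (𝓝 (1 / 2 * ∫ t, (f (x - t) - f (x + t)) / (t : ℂ))) := by
  have hpos : ∀ᶠ ε : ℝ in 𝓝[>] 0, 0 < ε := self_mem_nhdsWithin
  have hD := integrable_odd_quotient f x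
  have h := tendsto_integral_filter_of_dominated_convergence
    (F := fun (ε t : ℝ) => (f (x - t) - f (x + t)) / (t : ℂ) * ((t * k ε t : ℝ) : ℂ))
    (f := fun t : ℝ => (f (x - t) - f (x + t)) / (t : ℂ)) (l := 𝓝[>] (0 : ℝ)) (μ := volume)
    (fun t => ‖(f (x - t) - f (x + t)) / (t : ℂ)‖)
    (Eventually.of_forall fun ε => hD.aestronglyMeasurable.mul
      (Complex.measurable_ofReal.comp (measurable_id.mul (hk ε))).aestronglyMeasurable)
    (hpos.mono fun ε hε => Eventually.of_forall fun t => by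
      rw [norm_mul, Complex.norm_real]
      exact mul_le_of_le_one_right (norm_nonneg _) (h1 ε hε t))
    hD.norm
    (by
      filter_upwards [compl_mem_ae_iff.mpr (measure_singleton (0 : ℝ))] with t ht
      have := (Complex.continuous_ofReal.tendsto 1).comp (hlim t (by simpa using ht))
      simpa using this.const_mul ((f (x - t) - f (x + t)) / (t : ℂ)))
  refine (h.const_mul (1 / 2)).congr' (hpos.mono fun ε hε => ?_)
  exact (integral_mul_odd_kernel f x (hk ε) (hodd ε) (hB ε hε)).symm

/-- The Abel-regularized symbol `i sgn(ξ) e^{-2πδ|ξ|}`. -/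
def abelSymbol (δ ξ : ℝ) : ℂ := hilbertSymbol ξ * (Real.exp (-(2 * Real.pi * δ) * |ξ|) : ℂ)

theorem measurable_abelSymbol (δ : ℝ) : Measurable (abelSymbol δ) :=
  measurable_hilbertSymbol.mul (by fun_prop)

theorem norm_abelSymbol_le {δ : ℝ} (hδ : 0 ≤ δ) (ξ : ℝ) : ‖abelSymbol δ ξ‖ ≤ 1 := by
  rw [abelSymbol, norm_mul, Complex.norm_real, Real.norm_of_nonneg (Real.exp_pos _).le]
  refine mul_le_one₀ (norm_hilbertSymbol_le ξ) (Real.exp_pos _).le (Real.exp_le_one_iff.mpr ?_)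
  have : 0 ≤ 2 * Real.pi * δ * |ξ| := by positivity
  linarith

theorem integrable_exp_neg_mul_abs {b : ℝ} (hb : 0 < b) :
    Integrable fun ξ : ℝ => Real.exp (-b * |ξ|) := by
  rw [← integrableOn_univ, ← Set.Iic_union_Ioi (a := (0 : ℝ)), integrableOn_union]
  refine ⟨(integrableOn_exp_mul_Iic hb 0).congr_fun (fun ξ hξ => ?_) measurableSet_Iic,
    (integrableOn_exp_mul_Ioi (neg_lt_zero.mpr hb) 0).congr_fun (fun ξ hξ => ?_) measurableSet_Ioi⟩
  · simp only [abs_of_nonpos (Set.mem_Iic.mp hξ)]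
    ring_nf
  · simp only [abs_of_pos (Set.mem_Ioi.mp hξ)]

theorem integrable_abelSymbol {δ : ℝ} (hδ : 0 < δ) : Integrable (abelSymbol δ) := by
  refine Integrable.mono' (integrable_exp_neg_mul_abs (b := 2 * Real.pi * δ) (by positivity))
    (measurable_abelSymbol δ).aestronglyMeasurable (Eventually.of_forall fun ξ => ?_)
  rw [abelSymbol, norm_mul, Complex.norm_real, Real.norm_of_nonneg (Real.exp_pos _).le]
  exact mul_le_of_le_one_left (Real.exp_pos _).le (norm_hilbertSymbol_le ξ)

theorem norm_exp_mul_I_mul (x ξ : ℝ) :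
    ‖Complex.exp (2 * Real.pi * x * Complex.I * ξ)‖ = 1 := by
  rw [Complex.norm_exp]
  simp

/-- The inverse Fourier transform of the regularized symbol is the conjugate Poisson kernel. -/
theorem integral_exp_mul_abelSymbol {δ : ℝ} (hδ : 0 < δ) (t : ℝ) :
    ∫ ξ : ℝ, Complex.exp (2 * Real.pi * t * Complex.I * ξ) * abelSymbol δ ξ =
      -(1 / (Real.pi : ℂ)) * ((t / (t ^ 2 + δ ^ 2) : ℝ) : ℂ) := by
  have hπ := Real.pi_pos
  have hint : Integrable fun ξ : ℝ =>
      Complex.exp (2 * Real.pi * t * Complex.I * ξ) * abelSymbol δ ξ := by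
    refine (integrable_abelSymbol hδ).bdd_mul (c := 1) (by fun_prop)
      (Eventually.of_forall fun ξ => (norm_exp_mul_I_mul t ξ).le)
  set a : ℂ := 2 * Real.pi * t * Complex.I - 2 * Real.pi * δ with ha
  set b : ℂ := 2 * Real.pi * t * Complex.I + 2 * Real.pi * δ with hb
  have har : a.re < 0 := by
    simp [ha]; positivity
  have hbr : 0 < b.re := by
    simp [hb]; positivity
  rw [← intervalIntegral.integral_Iic_add_Ioi (b := (0 : ℝ)) hint.integrableOn hint.integrableOn]
  have hI : ∫ ξ in Set.Ioi (0 : ℝ), Complex.exp (2 * Real.pi * t * Complex.I * ξ) * abelSymbol δ ξ =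
      Complex.I * (-1 / a) := by
    have := integral_exp_mul_complex_Ioi har 0
    simp only [Complex.ofReal_zero, mul_zero, Complex.exp_zero] at this
    rw [← this, ← integral_const_mul]
    refine setIntegral_congr_fun measurableSet_Ioi fun ξ hξ => ?_
    have hξ' : 0 < ξ := hξ
    simp only [abelSymbol, hilbertSymbol, Real.sign_of_pos hξ', abs_of_pos hξ', Complex.ofReal_exp]
    rw [mul_left_comm, ← mul_assoc, mul_assoc, ← Complex.exp_add]
    simp only [Complex.ofReal_one, mul_one, ha]
    congr 2
    push_cast
    ring
  have hJ : ∫ ξ in Set.Iic (0 : ℝ), Complex.exp (2 * Real.pi * t * Complex.I * ξ) * abelSymbol δ ξ =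
      -Complex.I * (1 / b) := by
    have := integral_exp_mul_complex_Iic hbr 0
    simp only [Complex.ofReal_zero, mul_zero, Complex.exp_zero] at this
    rw [← this, ← integral_const_mul, integral_Iic_eq_integral_Iio, integral_Iic_eq_integral_Iio]
    refine setIntegral_congr_fun measurableSet_Iio fun ξ hξ => ?_
    have hξ' : ξ < 0 := hξ
    simp only [abelSymbol, hilbertSymbol, Real.sign_of_neg hξ', abs_of_neg hξ', Complex.ofReal_exp]
    rw [mul_left_comm, ← mul_assoc, mul_assoc, ← Complex.exp_add]
    simp only [Complex.ofReal_neg, Complex.ofReal_one, mul_neg, mul_one, hb]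
    congr 2
    push_cast
    ring
  rw [hI, hJ]
  have ha0 : a ≠ 0 := fun h => by simp [h] at har
  have hb0 : b ≠ 0 := fun h => by simp [h] at hbr
  have hden : ((t : ℂ) ^ 2 + (δ : ℂ) ^ 2) ≠ 0 := by
    have : (t ^ 2 + δ ^ 2 : ℝ) ≠ 0 := by positivity
    exact_mod_cast this
  have hπ' : (Real.pi : ℂ) ≠ 0 := by exact_mod_cast hπ.ne'
  -- The half-lines contribute `-i/b` and `-i/a`; their sum `-i(a+b)/(ab)` has numerator `4πt` and
  -- denominator `-4π²(t²+δ²)`.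
  have hab : a * b = -(4 * Real.pi ^ 2 * ((t : ℂ) ^ 2 + (δ : ℂ) ^ 2)) := by
    rw [ha, hb]
    linear_combination (4 * (Real.pi : ℂ) ^ 2 * t ^ 2) * Complex.I_sq
  have hsum : -Complex.I * (1 / b) + Complex.I * (-1 / a) = -Complex.I * (a + b) / (a * b) := by
    field_simp
    ring
  have hab' : -Complex.I * (a + b) = 4 * Real.pi * t := by
    rw [ha, hb]
    linear_combination (-4 * (Real.pi : ℂ) * t) * Complex.I_sq
  rw [hsum, hab, hab']
  push_cast
  field_simp

/-- The multiplication formula `∫ â f = ∫ a f̂`, with `a` the regularized symbol times the character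
at `x`, whose transform is the conjugate Poisson kernel centred at `x`. -/
theorem integral_mul_conjPoisson (f : 𝓢(ℝ, ℂ)) (x : ℝ) {δ : ℝ} (hδ : 0 < δ) :
    -(1 / (Real.pi : ℂ)) * ∫ t, f (x - t) * ((t / (t ^ 2 + δ ^ 2) : ℝ) : ℂ) =
      ∫ ξ : ℝ, Complex.exp (2 * Real.pi * x * Complex.I * ξ) * abelSymbol δ ξ * 𝓕 f ξ := by
  set a : ℝ → ℂ := fun ξ => Complex.exp (2 * Real.pi * x * Complex.I * ξ) * abelSymbol δ ξ with ha
  have hai : Integrable a :=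
    (integrable_abelSymbol hδ).bdd_mul (c := 1) (by fun_prop)
      (Eventually.of_forall fun ξ => (norm_exp_mul_I_mul x ξ).le)
  have hFa : ∀ y, 𝓕 a y =
      -(1 / (Real.pi : ℂ)) * (((x - y) / ((x - y) ^ 2 + δ ^ 2) : ℝ) : ℂ) := by
    intro y
    rw [← integral_exp_mul_abelSymbol hδ, Real.fourier_real_eq_integral_exp_smul]
    refine integral_congr_ae (Eventually.of_forall fun ξ => ?_)
    simp only [ha, smul_eq_mul]
    rw [← mul_assoc, ← Complex.exp_add]
    congr 2
    push_cast
    ring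
  have h := integral_fourier_mul_eq hai (f.integrable (μ := volume))
  rw [← SchwartzMap.fourier_coe] at h
  rw [← h, ← integral_const_mul, ← integral_sub_left_eq_self _ volume x]
  refine integral_congr_ae (Eventually.of_forall fun y => ?_)
  simp only [hFa, sub_sub_cancel]
  ring

theorem integrable_hilbertSymbol_mul (f : 𝓢(ℝ, ℂ)) :
    Integrable fun ξ => hilbertSymbol ξ * f ξ :=
  f.integrable.bdd_mul (c := 1) measurable_hilbertSymbol.aestronglyMeasurable
    (Eventually.of_forall norm_hilbertSymbol_le)

theorem tendsto_integral_abelSymbol (f : 𝓢(ℝ, ℂ)) (x : ℝ) :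
    Tendsto (fun δ : ℝ => ∫ ξ : ℝ,
        Complex.exp (2 * Real.pi * x * Complex.I * ξ) * abelSymbol δ ξ * 𝓕 f ξ) (𝓝[>] 0)
      (𝓝 (𝓕⁻ (fun ξ => hilbertSymbol ξ * 𝓕 f ξ) x)) := by
  have hg : 𝓕⁻ (fun ξ => hilbertSymbol ξ * 𝓕 f ξ) x = ∫ ξ : ℝ,
      Complex.exp (2 * Real.pi * x * Complex.I * ξ) * hilbertSymbol ξ * 𝓕 f ξ := by
    rw [Real.fourierInv_eq_fourier_neg, Real.fourier_real_eq_integral_exp_smul]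
    refine integral_congr_ae (Eventually.of_forall fun ξ => ?_)
    simp only [smul_eq_mul]
    rw [← mul_assoc]
    congr 3
    push_cast
    ring
  rw [hg]
  have hpos : ∀ᶠ δ : ℝ in 𝓝[>] 0, 0 < δ := self_mem_nhdsWithin
  refine tendsto_integral_filter_of_dominated_convergence (fun ξ => ‖𝓕 f ξ‖)
    (Eventually.of_forall fun δ => ?_) (hpos.mono fun δ hδ => Eventually.of_forall fun ξ => ?_)
    ((𝓕 f).integrable.norm) (Eventually.of_forall fun ξ => ?_)
  · exact ((Continuous.measurable (by fun_prop)).mul (measurable_abelSymbol δ)).mul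
      (𝓕 f).continuous.measurable |>.aestronglyMeasurable
  · rw [norm_mul, norm_mul, norm_exp_mul_I_mul, one_mul]
    exact mul_le_of_le_one_left (norm_nonneg _) (norm_abelSymbol_le hδ.le ξ)
  · have hc : Continuous fun δ : ℝ =>
        Complex.exp (2 * Real.pi * x * Complex.I * ξ) * abelSymbol δ ξ * 𝓕 f ξ := by
      unfold abelSymbol
      fun_prop
    have := (hc.tendsto 0).mono_left (nhdsWithin_le_nhds (s := Set.Ioi 0))
    simpa [abelSymbol] using this

theorem tendsto_conjPoisson (f : 𝓢(ℝ, ℂ)) (x : ℝ) :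
    Tendsto (fun δ : ℝ => ∫ t, f (x - t) * ((t / (t ^ 2 + δ ^ 2) : ℝ) : ℂ)) (𝓝[>] 0)
      (𝓝 (1 / 2 * ∫ t, (f (x - t) - f (x + t)) / (t : ℂ))) := by
  refine tendsto_integral_mul_odd_kernel f x (k := fun δ t => t / (t ^ 2 + δ ^ 2))
    (fun δ => by fun_prop) (fun δ t => by simp [neg_div]) (fun δ hδ t => ?_) (fun δ hδ t => ?_)
    (fun t ht => ?_)
  -- The bound `|t|δ ≤ t²+δ²`.
  · rw [abs_div, abs_of_pos (a := t ^ 2 + δ ^ 2) (by positivity), div_le_iff₀ (by positivity),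
      inv_mul_eq_div, le_div_iff₀ hδ, ← sq_abs t]
    nlinarith [sq_nonneg (|t| - δ), sq_nonneg |t|, sq_nonneg δ]
  · rw [← mul_div_assoc, abs_div, abs_of_pos (a := t ^ 2 + δ ^ 2) (by positivity),
      div_le_one (by positivity), ← sq, abs_of_nonneg (by positivity)]
    nlinarith [sq_nonneg δ]
  · have hc : ContinuousAt (fun δ : ℝ => t * (t / (t ^ 2 + δ ^ 2))) 0 := by
      have : t ^ 2 + (0 : ℝ) ^ 2 ≠ 0 := by simpa using ht
      exact continuousAt_const.mul (continuousAt_const.div (by fun_prop) this)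
    have := hc.tendsto.mono_left (nhdsWithin_le_nhds (s := Set.Ioi 0))
    have h1 : t * (t / (t ^ 2 + (0 : ℝ) ^ 2)) = 1 := by
      field_simp
      simp
    rwa [h1] at this

theorem tendsto_truncated (f : 𝓢(ℝ, ℂ)) (x : ℝ) :
    Tendsto (fun ε : ℝ => ∫ y in {y : ℝ | ε < |x - y|}, f y / ((x - y : ℝ) : ℂ)) (𝓝[>] 0)
      (𝓝 (1 / 2 * ∫ t, (f (x - t) - f (x + t)) / (t : ℂ))) := by
  have hset : ∀ ε : ℝ, MeasurableSet {t : ℝ | ε < |t|} := fun ε =>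
    measurableSet_lt measurable_const measurable_norm
  have h := tendsto_integral_mul_odd_kernel f x
    (k := fun ε t => if ε < |t| then t⁻¹ else 0)
    (fun ε => Measurable.ite (hset ε) measurable_inv measurable_const)
    (fun ε t => by simp only [abs_neg]; split_ifs <;> simp [inv_neg])
    (fun ε hε t => by
      split_ifs with ht
      · rw [abs_inv]
        exact inv_anti₀ hε ht.le
      · simpa using hε.le)
    (fun ε hε t => by
      split_ifs with ht
      · have : t ≠ 0 := abs_pos.mp (hε.trans ht)
        simp [this]
      · simp)
    (fun t ht => by
      refine tendsto_const_nhds.congr' ?_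
      filter_upwards [nhdsWithin_le_nhds (s := Set.Ioi 0)
        (Iio_mem_nhds (abs_pos.mpr ht))] with ε hε
      rw [if_pos (Set.mem_Iio.mp hε), mul_inv_cancel₀ ht])
  refine h.congr fun ε => ?_
  have hs : MeasurableSet {y : ℝ | ε < |x - y|} :=
    (hset ε).preimage (measurable_const.sub measurable_id)
  rw [← integral_indicator hs, ← integral_sub_left_eq_self _ volume x]
  refine integral_congr_ae (Eventually.of_forall fun y => ?_)
  simp only [Set.indicator_apply, Set.mem_ofPred_eq, sub_sub_cancel]
  split_ifs <;> simp [div_eq_mul_inv]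

/-- On Schwartz functions the principal value Hilbert transform is the Fourier multiplier
`i sgn ξ`. -/
theorem isPVHilbert_fourierInv (f : 𝓢(ℝ, ℂ)) :
    IsPVHilbert f (𝓕⁻ (fun ξ => hilbertSymbol ξ * 𝓕 f ξ)) := by
  intro x
  have hpos : ∀ᶠ δ : ℝ in 𝓝[>] 0, 0 < δ := self_mem_nhdsWithin
  have h1 := (tendsto_conjPoisson f x).const_mul (-(1 / (Real.pi : ℂ)))
  have h2 := (tendsto_integral_abelSymbol f x).congr'
    (hpos.mono fun δ hδ => (integral_mul_conjPoisson f x hδ).symm)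
  -- The Abel means converge both to the multiplier and to the odd quotient integral, which is also
  -- the limit of the truncations.
  rw [tendsto_nhds_unique h2 h1]
  exact (tendsto_truncated f x).const_mul _

/-! ### The pairing on Schwartz functions -/

theorem besselRep_schwartz (s : ℝ) (f : 𝓢(ℝ, ℂ)) :
    besselRep s (f : 𝓢'(ℝ, ℂ)) =
      (SchwartzMap.fourierMultiplierCLM ℂ
        (fun x : ℝ => (((1 + ‖x‖ ^ 2) ^ (s / 2) : ℝ) : ℂ)) f).toLp 2 volume := by
  apply besselRep_eq
  rw [besselPotential, Lp.toTemperedDistribution_toLp_eq,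
    fourierMultiplierCLM_toTemperedDistributionCLM_eq (by fun_prop)]

theorem fourier_fourierMultiplierCLM_apply {m : ℝ → ℂ} (hm : m.HasTemperateGrowth) (f : 𝓢(ℝ, ℂ))
    (ξ : ℝ) : 𝓕 (SchwartzMap.fourierMultiplierCLM ℂ m f) ξ = m ξ * 𝓕 f ξ := by
  rw [SchwartzMap.fourierMultiplierCLM_apply, FourierTransform.fourier_fourierInv_eq,
    SchwartzMap.smulLeftCLM_apply_apply hm, smul_eq_mul]

/-- The integral is the distribution `𝓕⁻ m` tested on `φ`, so the transform moves to `φ` by duality,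
even though `m` is only in `L²`. -/
theorem integral_toLp_mul_fourierInv (φ : 𝓢(ℝ, ℂ)) (m : Lp ℂ 2 (volume : Measure ℝ)) :
    ∫ y : ℝ, φ.toLp 2 volume y * (𝓕⁻ m : Lp ℂ 2 (volume : Measure ℝ)) y =
      ∫ ξ : ℝ, 𝓕 φ (-ξ) * m ξ := by
  have h1 : ∫ y : ℝ, φ.toLp 2 volume y * (𝓕⁻ m : Lp ℂ 2 (volume : Measure ℝ)) y =
      ((𝓕⁻ m : Lp ℂ 2 (volume : Measure ℝ)) : 𝓢'(ℝ, ℂ)) φ := by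
    rw [Lp.toTemperedDistribution_apply]
    apply integral_congr_ae
    filter_upwards [φ.coeFn_toLp 2 volume] with y hy
    rw [hy, smul_eq_mul]
  rw [h1, ← Lp.fourierInv_toTemperedDistribution_eq, TemperedDistribution.fourierInv_apply,
    Lp.toTemperedDistribution_apply]
  refine integral_congr_ae (Eventually.of_forall fun ξ => ?_)
  simp only [smul_eq_mul]
  rw [SchwartzMap.fourierInv_coe, Real.fourierInv_eq_fourier_neg, SchwartzMap.fourier_coe]

theorem integral_mul_fourierInv_eq {u m : ℝ → ℂ} (hu : Integrable u) (hm : Integrable m) :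
    ∫ y, u y * 𝓕⁻ m y = ∫ ξ, 𝓕 u (-ξ) * m ξ := by
  rw [Real.fourierInv_eq_fourier_comp_neg, ← integral_fourier_mul_eq hu hm.comp_neg, ← integral_neg_eq_self]
  simp

/-- On Schwartz functions the duality pairing with the Hilbert transform is a Lebesgue integral. -/
theorem dualityPairing_schwartz_hilbert (s : ℝ) (u f : 𝓢(ℝ, ℂ)) :
    dualityPairing s (u : 𝓢'(ℝ, ℂ)) (hilbert (-s) (f : 𝓢'(ℝ, ℂ))) =
      ∫ y : ℝ, u y * 𝓕⁻ (fun ξ => hilbertSymbol ξ * 𝓕 f ξ) y := by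
  have hm : ∀ t : ℝ, (fun x : ℝ => (((1 + ‖x‖ ^ 2) ^ (t / 2) : ℝ) : ℂ)).HasTemperateGrowth :=
    fun t => by fun_prop
  rw [dualityPairing, besselRep_hilbert, besselRep_schwartz, besselRep_schwartz, hilbertL2,
    integral_toLp_mul_fourierInv,
    integral_mul_fourierInv_eq u.integrable (integrable_hilbertSymbol_mul (𝓕 f))]
  apply integral_congr_ae
  set v := SchwartzMap.fourierMultiplierCLM ℂ
    (fun x : ℝ => (((1 + ‖x‖ ^ 2) ^ (-s / 2) : ℝ) : ℂ)) f with hv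
  have h2 : (𝓕 (v.toLp 2 volume) : Lp ℂ 2 (volume : Measure ℝ)) =ᵐ[volume]
      (𝓕 v : 𝓢(ℝ, ℂ)) := by
    rw [SchwartzMap.toLp_fourier_eq]
    exact (𝓕 v).coeFn_toLp 2 volume
  filter_upwards [(memLp_hilbertSymbol_mul (𝓕 (v.toLp 2 volume))).coeFn_toLp, h2] with ξ h1 h2
  rw [h1, h2, hv, fourier_fourierMultiplierCLM_apply (hm s),
    fourier_fourierMultiplierCLM_apply (hm (-s)), norm_neg, ← SchwartzMap.fourier_coe]
  -- The weights are even, so those at `-ξ` and `ξ` cancel exactly.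
  have h3 : (((1 + ‖ξ‖ ^ 2) ^ (s / 2) : ℝ) : ℂ) * (((1 + ‖ξ‖ ^ 2) ^ (-s / 2) : ℝ) : ℂ) = 1 := by
    rw [← Complex.ofReal_mul, ← Real.rpow_add (by positivity)]
    simp [neg_div]
  linear_combination (𝓕 u (-ξ) * (hilbertSymbol ξ * 𝓕 f ξ)) * h3

theorem integrable_mul_fourierInv {u m : ℝ → ℂ} (hu : Integrable u) (hm : Integrable m) :
    Integrable fun y => u y * 𝓕⁻ m y := by
  have hc : Continuous (𝓕 fun ξ => m (-ξ)) :=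
    VectorFourier.fourierIntegral_continuous (L := innerₗ ℝ) Real.continuous_fourierChar
      continuous_inner hm.comp_neg
  rw [Real.fourierInv_eq_fourier_comp_neg]
  exact hu.mul_bdd hc.aestronglyMeasurable (Eventually.of_forall fun y =>
    VectorFourier.norm_fourierIntegral_le_integral_norm _ _ _ _ _)

end HilbertForm

end

/-! ### The main estimate -/

theorem lemmaL (χ : ℝ → ℂ) (hχ : ContDiff ℝ ∞ χ) (hχc : HasCompactSupport χ) :
    ∃ C : ℝ, ∀ h : ℝ, 0 < h → h ≤ 1 →
      -- `w ∈ H^{1/2}`: the integral is the pairing of `H^{1/2}` with `H^{-1/2}`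
      (∀ w : 𝓢'(ℝ, ℂ), TemperedDistribution.MemSobolev (1 / 2) 2 w →
        TemperedDistribution.MemSobolev (1 / 2) 2
          (TemperedDistribution.smulLeftCLM ℂ (fun y : ℝ => χ (h * y)) w) ∧
        TemperedDistribution.MemSobolev (-(1 / 2)) 2
          (TemperedDistribution.derivCLM ℂ w) ∧
        TemperedDistribution.MemSobolev (-(1 / 2)) 2
          (HilbertForm.hilbert (-(1 / 2)) (TemperedDistribution.derivCLM ℂ w)) ∧
        ‖HilbertForm.dualityPairing (1 / 2)
            (TemperedDistribution.smulLeftCLM ℂ (fun y : ℝ => χ (h * y)) w)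
            (HilbertForm.hilbert (-(1 / 2)) (TemperedDistribution.derivCLM ℂ w))‖
          ≤ C * HilbertForm.sobolevNorm (1 / 2) w ^ 2) ∧
      -- `w` a Schwartz function: a Lebesgue integral, with the principal value Hilbert transform
      (∀ w : 𝓢(ℝ, ℂ), ∃ g : ℝ → ℂ, HilbertForm.IsPVHilbert (deriv w) g ∧
        Integrable (fun y : ℝ => χ (h * y) * w y * g y) ∧
        HilbertForm.dualityPairing (1 / 2)
            (TemperedDistribution.smulLeftCLM ℂ (fun y : ℝ => χ (h * y)) (w : 𝓢'(ℝ, ℂ)))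
            (HilbertForm.hilbert (-(1 / 2)) (TemperedDistribution.derivCLM ℂ (w : 𝓢'(ℝ, ℂ))))
          = ∫ y : ℝ, χ (h * y) * w y * g y ∧
        ‖∫ y : ℝ, χ (h * y) * w y * g y‖
          ≤ C * HilbertForm.sobolevNorm (1 / 2) (w : 𝓢'(ℝ, ℂ)) ^ 2) := by
  set φ : 𝓢(ℝ, ℂ) := hχc.toSchwartzMap hχ with hφ
  set K : ℝ := ∫ η : ℝ, (2 * (1 + ‖η‖ ^ 2)) ^ ((1 / 2 : ℝ) / 2) * ‖𝓕 φ η‖ with hK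
  have hK0 : 0 ≤ K := integral_nonneg fun η => by positivity
  -- `K` bounds multiplication by `χ(h·)` on `H^{1/2}` for every `h ≤ 1`; `2π` bounds the
  -- derivative.
  refine ⟨K * (2 * Real.pi), fun h hh hh1 => ?_⟩
  have hsm : ContDiff ℝ ∞ fun y : ℝ => χ (h * y) := hχ.comp (contDiff_const.mul contDiff_id)
  have hcs : HasCompactSupport fun y : ℝ => χ (h * y) :=
    hχc.comp_homeomorph (Homeomorph.mulLeft₀ h hh.ne')
  set φh : 𝓢(ℝ, ℂ) := hcs.toSchwartzMap hsm with hφh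
  have hcoe : (φh : ℝ → ℂ) = fun y : ℝ => χ (h * y) := rfl
  have hle := HilbertForm.integral_weight_mul_norm_fourier_dilation_le
    (r := (1 / 2 : ℝ) / 2) (by norm_num) φ φh hh hh1 (fun y => rfl)
  have key : ∀ w : 𝓢'(ℝ, ℂ), TemperedDistribution.MemSobolev (1 / 2) 2 w →
      TemperedDistribution.MemSobolev (1 / 2) 2
        (TemperedDistribution.smulLeftCLM ℂ (fun y : ℝ => χ (h * y)) w) ∧
      TemperedDistribution.MemSobolev (-(1 / 2)) 2 (TemperedDistribution.derivCLM ℂ w) ∧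
      TemperedDistribution.MemSobolev (-(1 / 2)) 2
        (HilbertForm.hilbert (-(1 / 2)) (TemperedDistribution.derivCLM ℂ w)) ∧
      ‖HilbertForm.dualityPairing (1 / 2)
          (TemperedDistribution.smulLeftCLM ℂ (fun y : ℝ => χ (h * y)) w)
          (HilbertForm.hilbert (-(1 / 2)) (TemperedDistribution.derivCLM ℂ w))‖
        ≤ K * (2 * Real.pi) * HilbertForm.sobolevNorm (1 / 2) w ^ 2 := by
    intro w hw
    obtain ⟨hm, hmn⟩ :=
      HilbertForm.memSobolev_smulLeftCLM_and_norm_le (by norm_num) φh hw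
    obtain ⟨hd, hdn⟩ := HilbertForm.memSobolev_derivCLM_and_norm_le hw
    rw [hcoe] at hm hmn
    have hw0 : 0 ≤ HilbertForm.sobolevNorm (1 / 2) w := norm_nonneg _
    refine ⟨hm, hd, HilbertForm.memSobolev_hilbert _ _, ?_⟩
    rw [HilbertForm.dualityPairing]
    refine (HilbertForm.norm_integral_mul_le _ _).trans ?_
    rw [HilbertForm.besselRep_hilbert]
    calc _ ≤ (K * HilbertForm.sobolevNorm (1 / 2) w) *
          (2 * Real.pi * HilbertForm.sobolevNorm (1 / 2) w) := by
          gcongr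
          · exact hmn.trans (mul_le_mul_of_nonneg_right hle hw0)
          · exact (HilbertForm.norm_hilbertL2_le _).trans hdn
      _ = _ := by ring
  refine ⟨key, fun w => ?_⟩
  set f : 𝓢(ℝ, ℂ) := SchwartzMap.derivCLM ℂ ℂ w with hf
  have hgrow : (fun y : ℝ => χ (h * y)).HasTemperateGrowth := hcs.hasTemperateGrowth hsm
  set u : 𝓢(ℝ, ℂ) := SchwartzMap.smulLeftCLM ℂ (fun y : ℝ => χ (h * y)) w with hu
  have hua : ∀ y, u y = χ (h * y) * w y := fun y => SchwartzMap.smulLeftCLM_apply_apply hgrow w y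
  have hpair : HilbertForm.dualityPairing (1 / 2)
      (TemperedDistribution.smulLeftCLM ℂ (fun y : ℝ => χ (h * y)) (w : 𝓢'(ℝ, ℂ)))
      (HilbertForm.hilbert (-(1 / 2)) (TemperedDistribution.derivCLM ℂ (w : 𝓢'(ℝ, ℂ)))) =
      ∫ y : ℝ, χ (h * y) * w y * 𝓕⁻ (fun ξ => HilbertForm.hilbertSymbol ξ * 𝓕 f ξ) y := by
    rw [HilbertForm.smulLeftCLM_toTemperedDistributionCLM hgrow,
      TemperedDistribution.derivCLM_toTemperedDistributionCLM_eq ℂ,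
      HilbertForm.dualityPairing_schwartz_hilbert]
    simp only [← hu, hua, ← hf]
  refine ⟨𝓕⁻ (fun ξ => HilbertForm.hilbertSymbol ξ * 𝓕 f ξ),
    HilbertForm.isPVHilbert_fourierInv f, ?_, hpair, ?_⟩
  · have := HilbertForm.integrable_mul_fourierInv (u.integrable (μ := volume))
      (HilbertForm.integrable_hilbertSymbol_mul (𝓕 f))
    simpa only [hua] using this
  · rw [← hpair]
    exact (key _ w.memSobolev).2.2.2
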